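/- **Theorem 6.** Let $1\le k\le d$. For a $d\times d$ real matrix $V$ and $0\le j\le d$ let $\Psi_j(V)=\frac{j+1}{j!}\,\mathcal E_j(V)$, where $\mathcal E_j(V)$ is the sum of the $j\times j$ principal minors of $V$ (for symmetric $V$, the elementary symmetric function of degree $j$ of its eigenvalues; $\Psi_0=1$), and let $\nabla_{\Psi_j}[V]$ be the $d\times d$ matrix of partial derivatives of $\Psi_j$ with respect to the entries of $V$. Let $\mathcal T$ be a measurable space which also carries a topology (the topology is used only for the support below), let $f:\mathcal T\to\mathbb R^d$ be measurable with $\{f(t):t\in\mathcal T\}$ compact, let $\Xi$ be the set of all probability measures on $\mathcal T$, and for $\xi\in\Xi$ let $M(\xi)=\int_{\mathcal T} f(t)f^\top(t)\,\xi(dt)$. Put $\tilde\psi_k(\xi)=\Psi_k^{-1/k}[M^{-1}(\xi)]$ if $M(\xi)$ is nonsingular and $\tilde\psi_k(\xi)=0$ otherwise. Let $\xi_k^*\in\Xi$ be such that $M_*:=M(\xi_k^*)$ is positive definite. Then $\xi_k^*$ maximises $\tilde\psi_k$ over $\Xi$ if and only if $$\max_{t\in\mathcal T} f^\top(t)M_*^{-1}\,\frac{\nabla_{\Psi_k}[M_*^{-1}]}{\Psi_k[M_*^{-1}]}\,M_*^{-1}f(t)\le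 k, \qquad (a)$$ or, equivalently, if and only if $$\max_{t\in\mathcal T}\left\{f^\top(t)M_*^{-1}f(t)-f^\top(t)\,\frac{\nabla_{\Psi_{d-k}}[M_*]}{\Psi_{d-k}[M_*]}\,f(t)\right\}\le k. \qquad (b)$$ (The maxima exist.) Moreover, if $\xi_k^*$ maximises $\tilde\psi_k$, then the expressions maximised in (a) and (b) are both equal to $k$ at every $t$ in the support of $\xi_k^*$ at which $f$ is continuous, and at every $t$ such that $f(t)$ lies in the support of the image of $\xi_k^*$ under $f$. For $k=1$, $\xi_k^*$ maximises $\tilde\psi_k$ if and only if it is A-optimal (it minimises $\operatorname{tr} M^{-1}(\xi)$ over the $\xi\in\Xi$ with $M(\xi)$ positive definite); for $k=d$, $\xi_k^*$ maximises $\tilde\psi_k$ if and only if it is D-optimal (it maximises $\det M(\xi)$ over $\Xi$). -/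

import Mathlib

open MeasureTheory Matrix

noncomputable section

namespace OptDesign

variable {d : ℕ}

/-- `E_k(V)`: the sum of the `k × k` principal minors of `V`, i.e. the elementary symmetric
function of degree `k` of the eigenvalues of `V` (see `esymm_eq_eigenvalues`). -/
def esymm (k : ℕ) (V : Matrix (Fin d) (Fin d) ℝ) : ℝ :=
  ∑ s ∈ (Finset.univ : Finset (Fin d)).powersetCard k,
    (V.submatrix (fun i : s => (i : Fin d)) (fun i : s => (i : Fin d))).det

/-- For a symmetric matrix, `esymm k V` is the elementary symmetric function of degree `k` of the
eigenvalues of `V`, counted with multiplicity. -/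
theorem esymm_eq_eigenvalues (k : ℕ) (hk : k ≤ d) (V : Matrix (Fin d) (Fin d) ℝ)
    (hV : V.IsHermitian) :
    esymm k V =
      ∑ s ∈ (Finset.univ : Finset (Fin d)).powersetCard k, ∏ i ∈ s, hV.eigenvalues i := by
  have h1 := Matrix.charpoly_coeff_eq_sum_minors V k (by simpa using hk)
  rw [Fintype.card_fin, hV.charpoly_eq] at h1
  have h2 := Multiset.prod_X_sub_C_coeff
    ((Finset.univ : Finset (Fin d)).val.map hV.eigenvalues) (k := d - k) (by simp)
  rw [Multiset.map_map] at h2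
  have h3 : Multiset.card ((Finset.univ : Finset (Fin d)).val.map hV.eigenvalues) - (d - k) = k := by
    simp; omega
  rw [h3, Finset.esymm_map_val] at h2
  exact mul_left_cancel₀ (pow_ne_zero k (by norm_num : (-1 : ℝ) ≠ 0)) (h1.symm.trans h2)

/-- `Ψ_k(V) = ((k + 1) / k!) E_k(V)`; in particular `Ψ_0 = 1`. -/
def Psi (k : ℕ) (V : Matrix (Fin d) (Fin d) ℝ) : ℝ :=
  ((k : ℝ) + 1) / (Nat.factorial k : ℝ) * esymm k V

/-- The gradient of a real function of a `d × d` matrix: the matrix of the partial derivatives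
with respect to the `d²` entries. -/
def matrixGradient (F : Matrix (Fin d) (Fin d) ℝ → ℝ) (V : Matrix (Fin d) (Fin d) ℝ) :
    Matrix (Fin d) (Fin d) ℝ :=
  Matrix.of fun i j => deriv (fun s : ℝ => F (V + s • Matrix.single i j 1)) 0

variable {T : Type*} [MeasurableSpace T]

/-- The information matrix `M(ξ) = ∫ f(t) f(t)ᵀ ξ(dt)`. -/
def infoMatrix (f : T → Fin d → ℝ) (ξ : ProbabilityMeasure T) : Matrix (Fin d) (Fin d) ℝ :=
  Matrix.of fun i j => ∫ t, f t i * f t j ∂(ξ : Measure T)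

open Classical in
/-- The criterion `Ψ_k(M(ξ)⁻¹) ^ (-1/k)`, with the usual value `0` if `M(ξ)` is singular (an
information matrix is positive semidefinite, so it is nonsingular iff it is positive definite). -/
def criterion (k : ℕ) (f : T → Fin d → ℝ) (ξ : ProbabilityMeasure T) : ℝ :=
  if (infoMatrix f ξ).PosDef then Psi k (infoMatrix f ξ)⁻¹ ^ (-(1 / (k : ℝ))) else 0

/-- `ξ` maximises the criterion over all designs (probability measures on `T`). -/
def IsOptimal (k : ℕ) (f : T → Fin d → ℝ) (ξ : ProbabilityMeasure T) : Prop :=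
  ∀ ν : ProbabilityMeasure T, criterion k f ν ≤ criterion k f ξ

/-- `f(t)ᵀ M⁻¹ (∇Ψ_k[M⁻¹] / Ψ_k[M⁻¹]) M⁻¹ f(t)` with `M = M(ξ)`. -/
def sensitivity (k : ℕ) (f : T → Fin d → ℝ) (ξ : ProbabilityMeasure T) (t : T) : ℝ :=
  let W := (infoMatrix f ξ)⁻¹
  f t ⬝ᵥ (W * ((Psi k W)⁻¹ • matrixGradient (Psi k) W) * W) *ᵥ f t

/-- `f(t)ᵀ M⁻¹ f(t) - f(t)ᵀ (∇Ψ_{d-k}[M] / Ψ_{d-k}[M]) f(t)` with `M = M(ξ)` and `k ≤ d`. -/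
def dualSensitivity (k : ℕ) (f : T → Fin d → ℝ) (ξ : ProbabilityMeasure T) (t : T) : ℝ :=
  let M := infoMatrix f ξ
  f t ⬝ᵥ M⁻¹ *ᵥ f t - f t ⬝ᵥ ((Psi (d - k) M)⁻¹ • matrixGradient (Psi (d - k)) M) *ᵥ f t

end OptDesign

end

noncomputable section
namespace OptDesign

variable {d : ℕ}

/-! As `x ↦ x ^ (-1/k)` is decreasing, optimality means that `E_k(M⁻¹)` is minimal at `M_*` among
nonsingular information matrices. Necessity of (a): mixing the design with a point mass at `t` moves
`M_*` along `(M_* + s f fᵀ) / (1 + s)`. Nonnegativity of the right derivative of `E_k` of the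
inverse at `s = 0` is (a) at `t`. Sufficiency: integrating (a) against a competing design bounds the
derivative of `E_k` at `M_*⁻¹` in direction `M_*⁻¹ M M_*⁻¹` by `k E_k(M_*⁻¹)`. A tangent inequality,
`esymm_inv_le_of_esymmDeriv_le`, turns this into `E_k(M_*⁻¹) ≤ E_k(M⁻¹)`; it follows from
simultaneous diagonalisation and convexity of `exp` and `-log`. The expressions in (a) and (b)
coincide: differentiate `E_{d-k}(M) = det M · E_k(M⁻¹)` along `M + s f fᵀ` (`esymmDeriv_dual`). By
Euler's identity the expression in (a) has mean exactly `k` under the design itself, so a bound by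
`k` forces equality almost everywhere, and by continuity on the support of the image. -/

/-! ### Algebra of the sums of principal minors -/

theorem esymm_eq_charpoly_coeff {k : ℕ} (hk : k ≤ d) (V : Matrix (Fin d) (Fin d) ℝ) :
    esymm k V = (-1) ^ k * V.charpoly.coeff (d - k) := by
  have h := Matrix.charpoly_coeff_eq_sum_minors V k (by simpa using hk)
  rw [Fintype.card_fin] at h
  rw [h, ← mul_assoc, ← mul_pow]
  simp [esymm]

theorem esymm_mul_comm {k : ℕ} (hk : k ≤ d) (A B : Matrix (Fin d) (Fin d) ℝ) :
    esymm k (A * B) = esymm k (B * A) := by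
  rw [esymm_eq_charpoly_coeff hk, esymm_eq_charpoly_coeff hk, Matrix.charpoly_mul_comm]

theorem esymm_smul (k : ℕ) (c : ℝ) (V : Matrix (Fin d) (Fin d) ℝ) :
    esymm k (c • V) = c ^ k * esymm k V := by
  rw [esymm, esymm, Finset.mul_sum]
  refine Finset.sum_congr rfl fun s hs => ?_
  rw [Finset.mem_powersetCard] at hs
  rw [Matrix.submatrix_smul, Pi.smul_apply, Pi.smul_apply, Matrix.det_smul]
  simp [hs.2]

theorem esymm_self (V : Matrix (Fin d) (Fin d) ℝ) : esymm d V = V.det := by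
  have h := esymm_eq_charpoly_coeff le_rfl V
  rw [h, Matrix.det_eq_sign_charpoly_coeff]
  simp

theorem esymm_one (V : Matrix (Fin d) (Fin d) ℝ) : esymm 1 V = V.trace := by
  rw [esymm, Finset.powersetCard_one, Finset.sum_map, Matrix.trace]
  refine Finset.sum_congr rfl fun i _ => ?_
  have : Unique (({i} : Finset (Fin d)) : Type) :=
    { default := ⟨i, by simp⟩, uniq := fun a => Subtype.ext (Finset.mem_singleton.1 a.2) }
  simp only [Function.Embedding.coeFn_mk]
  rw [Matrix.det_unique, Matrix.submatrix_apply]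
  have h := (default : (({i} : Finset (Fin d)) : Type)).2
  rw [Finset.mem_singleton] at h
  rw [h, Matrix.diag_apply]

theorem esymm_mul_diagonal (k : ℕ) (Q : Matrix (Fin d) (Fin d) ℝ) (D : Fin d → ℝ) :
    esymm k (Q * diagonal D) = ∑ s ∈ (Finset.univ : Finset (Fin d)).powersetCard k,
      (Q.submatrix (fun i : s => (i : Fin d)) (fun i : s => (i : Fin d))).det * ∏ i ∈ s, D i := by
  refine Finset.sum_congr rfl fun s _ => ?_
  have h : (Q * diagonal D).submatrix (fun i : s => (i : Fin d)) (fun i : s => (i : Fin d)) =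
      Q.submatrix (fun i : s => (i : Fin d)) (fun i : s => (i : Fin d)) *
        diagonal fun i : s => D i := by
    ext i j
    simp
  rw [h, Matrix.det_mul, Matrix.det_diagonal, Finset.prod_coe_sort s D]

theorem minor_pos {Q : Matrix (Fin d) (Fin d) ℝ} (hQ : Q.PosDef) (s : Finset (Fin d)) :
    0 < (Q.submatrix (fun i : s => (i : Fin d)) (fun i : s => (i : Fin d))).det :=
  (hQ.submatrix Subtype.val_injective).det_pos

theorem esymm_pos {k : ℕ} (hk : k ≤ d) {V : Matrix (Fin d) (Fin d) ℝ} (hV : V.PosDef) :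
    0 < esymm k V :=
  Finset.sum_pos (fun s _ => minor_pos hV s)
    (Finset.powersetCard_nonempty.2 (by simpa using hk))

/-- A product of `d - k` eigenvalues is the determinant times the inverse of the product of the
other `k`. Without eigenvalues: up to a factor, the characteristic polynomial of `A⁻¹` is that of
`A` reversed. -/
theorem esymm_sub_eq {k : ℕ} (hk : k ≤ d) (A : Matrix (Fin d) (Fin d) ℝ) (hA : A.det ≠ 0) :
    esymm (d - k) A = A.det * esymm k A⁻¹ := by
  have hu : IsUnit A := (Matrix.isUnit_iff_isUnit_det A).2 hA.isUnit
  have hC : (-1 : Polynomial ℝ) ^ d = Polynomial.C ((-1) ^ d) := by simp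
  rw [esymm_eq_charpoly_coeff hk, esymm_eq_charpoly_coeff (Nat.sub_le d k),
    Matrix.charpoly_inv A hu, ← Matrix.reverse_charpoly, mul_assoc, Fintype.card_fin, hC,
    Polynomial.coeff_C_mul, Polynomial.coeff_C_mul, Polynomial.coeff_reverse,
    Matrix.charpoly_natDegree_eq_dim, Fintype.card_fin, Polynomial.revAt_le (Nat.sub_le d k), Nat.sub_sub_self hk,
    Ring.inverse_eq_inv']
  have hs : (-1 : ℝ) ^ (d - k) = (-1) ^ k * (-1) ^ d := by
    obtain ⟨m, rfl⟩ := Nat.exists_eq_add_of_le hk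
    rw [Nat.add_sub_cancel_left, pow_add, ← mul_assoc, ← mul_pow]
    simp
  rw [hs]
  field_simp

/-- Two positive definite matrices are simultaneously diagonalised by a congruence. -/
theorem exists_simultaneous_diagonalization {W V : Matrix (Fin d) (Fin d) ℝ} (hW : W.PosDef)
    (hV : V.PosDef) : ∃ (P : Matrix (Fin d) (Fin d) ℝ) (e : Fin d → ℝ), P.det ≠ 0 ∧
      (∀ i, 0 < e i) ∧ W = P * Pᵀ ∧ V = P * diagonal e * Pᵀ := by
  open scoped MatrixOrder in
  obtain ⟨S, hS, hSW⟩ : ∃ S : Matrix (Fin d) (Fin d) ℝ, S.IsHermitian ∧ S * S = W :=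
    ⟨CFC.sqrt W, (Matrix.nonneg_iff_posSemidef.1 (CFC.sqrt_nonneg W)).isHermitian,
      CFC.sqrt_mul_sqrt_self W hW.posSemidef.nonneg⟩
  have hSd : S.det ≠ 0 := fun h => hW.det_pos.ne' (by rw [← hSW, Matrix.det_mul, h, zero_mul])
  have hSu : IsUnit S := (Matrix.isUnit_iff_isUnit_det S).2 hSd.isUnit
  have hSt : Sᵀ = S := by simpa [Matrix.IsHermitian, Matrix.conjTranspose_eq_transpose_of_trivial] using hS
  have hSi : (S⁻¹)ᵀ = S⁻¹ := by rw [Matrix.transpose_nonsing_inv, hSt]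
  have hC : (S⁻¹ * V * S⁻¹).PosDef := by
    have := (Matrix.IsUnit.posDef_star_left_conjugate_iff (x := V) (Matrix.isUnit_nonsing_inv_iff.2 hSu)).2 hV
    rwa [Matrix.star_eq_conjTranspose, Matrix.conjTranspose_eq_transpose_of_trivial, hSi] at this
  have hsp := hC.isHermitian.spectral_theorem
  set U := hC.isHermitian.eigenvectorUnitary
  have hU : (U : Matrix (Fin d) (Fin d) ℝ) * (U : Matrix (Fin d) (Fin d) ℝ)ᵀ = 1 := by
    have := Unitary.coe_mul_star_self U
    rwa [Unitary.coe_star, Matrix.star_eq_conjTranspose,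
      Matrix.conjTranspose_eq_transpose_of_trivial] at this
  refine ⟨S * U, hC.isHermitian.eigenvalues, ?_, hC.eigenvalues_pos, ?_, ?_⟩
  · rw [Matrix.det_mul]
    refine mul_ne_zero hSd fun h => ?_
    have := congrArg Matrix.det hU
    rw [Matrix.det_mul, h] at this
    simp at this
  · rw [Matrix.transpose_mul, hSt, Matrix.mul_assoc, ← Matrix.mul_assoc _ _ S, hU, Matrix.one_mul, hSW]
  · rw [Unitary.conjStarAlgAut_apply, Matrix.star_eq_conjTranspose,
      Matrix.conjTranspose_eq_transpose_of_trivial] at hsp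
    have h1 : S * (S⁻¹ * V * S⁻¹) * S = V := by
      rw [Matrix.mul_assoc S⁻¹, Matrix.mul_nonsing_inv_cancel_left _ _ hSd.isUnit,
        Matrix.nonsing_inv_mul_cancel_right _ _ hSd.isUnit]
    refine h1.symm.trans ?_
    rw [Matrix.transpose_mul, hSt]
    refine (congrArg (fun X => S * X * S) hsp).trans ?_
    simp only [Matrix.mul_assoc]
    rfl

/-! ### Directional derivatives -/

/-- The derivative of `esymm k` at `V` in the direction `H`. -/
def esymmDeriv (k : ℕ) (V H : Matrix (Fin d) (Fin d) ℝ) : ℝ :=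
  ∑ i, ∑ j, H i j * matrixGradient (esymm k) V i j

theorem esymmDeriv_smul (k : ℕ) (c : ℝ) (V H : Matrix (Fin d) (Fin d) ℝ) :
    esymmDeriv k V (c • H) = c * esymmDeriv k V H := by
  simp [esymmDeriv, Finset.mul_sum, mul_assoc]

section
attribute [local instance] Matrix.normedAddCommGroup Matrix.normedSpace

theorem differentiable_esymm (k : ℕ) :
    Differentiable ℝ (esymm k : Matrix (Fin d) (Fin d) ℝ → ℝ) := by
  unfold esymm
  simp only [Matrix.det_apply, Matrix.submatrix_apply]
  refine Differentiable.fun_sum fun s _ => Differentiable.fun_sum fun σ _ => ?_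
  have h1 : Differentiable ℝ fun V : Matrix (Fin d) (Fin d) ℝ => ∏ i : s, V (σ i) i :=
    by
    fun_prop
  exact h1.const_smul (Equiv.Perm.sign σ)

/-- Partial derivatives give the full differential because `esymm k` is polynomial in the entries.
The matrix norm serves only to make `fderiv` available. -/
theorem fderiv_esymm (k : ℕ) (V H : Matrix (Fin d) (Fin d) ℝ) :
    fderiv ℝ (esymm k) V H = esymmDeriv k V H := by
  have h : ∀ i j, matrixGradient (esymm k) V i j = fderiv ℝ (esymm k) V (Matrix.single i j 1) := by
    intro i j
    have h1 : HasDerivAt (fun s : ℝ => V + s • Matrix.single i j (1 : ℝ))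
        (Matrix.single i j (1 : ℝ)) 0 := by
      have := ((hasDerivAt_id (0 : ℝ)).smul_const (Matrix.single i j (1 : ℝ))).const_add V
      rwa [one_smul] at this
    have h2 : HasFDerivAt (esymm k) (fderiv ℝ (esymm k) V)
        (V + (0 : ℝ) • Matrix.single i j (1 : ℝ)) := by
      simpa using (differentiable_esymm k V).hasFDerivAt
    exact (h2.comp_hasDerivAt (0 : ℝ) h1).deriv
  conv_lhs => rw [Matrix.matrix_eq_sum_single H]
  simp only [map_sum, esymmDeriv, h]
  refine Finset.sum_congr rfl fun i _ => Finset.sum_congr rfl fun j _ => ?_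
  rw [← smul_eq_mul, ← map_smul, Matrix.smul_single]
  simp

theorem hasDerivAt_esymm_comp (k : ℕ) {γ : ℝ → Matrix (Fin d) (Fin d) ℝ}
    {H : Matrix (Fin d) (Fin d) ℝ} {t : ℝ} (h : ∀ i j, HasDerivAt (fun s => γ s i j) (H i j) t) :
    HasDerivAt (fun s => esymm k (γ s)) (esymmDeriv k (γ t) H) t := by
  rw [← fderiv_esymm]
  exact (differentiable_esymm k (γ t)).hasFDerivAt.comp_hasDerivAt t
    (hasDerivAt_pi.2 fun i => hasDerivAt_pi.2 fun j => h i j)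
end

theorem hasDerivAt_esymm_line (k : ℕ) (V H : Matrix (Fin d) (Fin d) ℝ) :
    HasDerivAt (fun s : ℝ => esymm k (V + s • H)) (esymmDeriv k V H) 0 := by
  have := hasDerivAt_esymm_comp k (γ := fun s => V + s • H) (H := H) (t := 0) fun i j => by
    simpa using ((hasDerivAt_id (0 : ℝ)).mul_const (H i j)).const_add (V i j)
  simpa using this

/-- Euler's identity for a homogeneous function of degree `k`. -/
theorem esymmDeriv_self (k : ℕ) (V : Matrix (Fin d) (Fin d) ℝ) :
    esymmDeriv k V V = k * esymm k V := by
  refine (hasDerivAt_esymm_line k V V).unique ?_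
  have h : (fun s : ℝ => esymm k (V + s • V)) = fun s : ℝ => (1 + s) ^ k * esymm k V := by
    ext s
    rw [← esymm_smul, add_smul, one_smul]
  rw [h]
  simpa using (((hasDerivAt_id (0 : ℝ)).const_add 1).pow k).mul_const (esymm k V)

/-! ### The tangent inequality -/

/-- Write `A⁻¹ = P Pᵀ` and `A⁻¹ B A⁻¹ = P diag(e) Pᵀ`, so that `B⁻¹ = P diag(1/e) Pᵀ`. All
quantities become sums over `k`-subsets with common nonnegative weights, and the comparison reduces
to positive numbers `e i`. -/
theorem esymm_inv_le_of_esymmDeriv_le {k : ℕ} (hk : k ≤ d) {A B : Matrix (Fin d) (Fin d) ℝ}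
    (hA : A.PosDef) (hB : B.PosDef)
    (h : esymmDeriv k A⁻¹ (A⁻¹ * B * A⁻¹) ≤ k * esymm k A⁻¹) :
    esymm k A⁻¹ ≤ esymm k B⁻¹ := by
  have hWt : (A⁻¹)ᵀ = A⁻¹ := by
    simpa [Matrix.IsHermitian, Matrix.conjTranspose_eq_transpose_of_trivial] using
      hA.inv.isHermitian
  have hV : (A⁻¹ * B * A⁻¹).PosDef := by
    have := (Matrix.IsUnit.posDef_star_left_conjugate_iff (x := B) hA.inv.isUnit).2 hB
    rwa [Matrix.star_eq_conjTranspose, Matrix.conjTranspose_eq_transpose_of_trivial, hWt] at this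
  obtain ⟨P, e, hP, he, hWP, hVP⟩ := exists_simultaneous_diagonalization hA.inv hV
  -- Principal minors of the Gram matrix `Pᵀ P`: nonnegative weights that do not depend on the
  -- diagonal factor.
  set m : Finset (Fin d) → ℝ := fun s =>
    ((Pᵀ * P).submatrix (fun i : s => (i : Fin d)) (fun i : s => (i : Fin d))).det with hm
  have hm0 : ∀ s, 0 ≤ m s := fun s => by
    refine ((Matrix.PosSemidef.submatrix ?_ _).det_nonneg)
    simpa [Matrix.conjTranspose_eq_transpose_of_trivial] using
      Matrix.posSemidef_conjTranspose_mul_self P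
  have hdiag : ∀ D : Fin d → ℝ, esymm k (P * diagonal D * Pᵀ) =
      ∑ s ∈ (Finset.univ : Finset (Fin d)).powersetCard k, m s * ∏ i ∈ s, D i := fun D => by
    rw [esymm_mul_comm hk, ← Matrix.mul_assoc, esymm_mul_diagonal]
  have hW : esymm k A⁻¹ = ∑ s ∈ (Finset.univ : Finset (Fin d)).powersetCard k, m s := by
    have := hdiag fun _ => 1
    simpa [← hWP] using this
  have hPt : Pᵀ.det ≠ 0 := by rwa [Matrix.det_transpose]
  have hBi : B⁻¹ = P * diagonal (fun i => (e i)⁻¹) * Pᵀ := by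
    have hB' : B = (Pᵀ)⁻¹ * diagonal e * P⁻¹ := by
      have h1 : A * (A⁻¹ * B * A⁻¹) * A = B := by
        rw [Matrix.mul_assoc A⁻¹, Matrix.mul_nonsing_inv_cancel_left _ _ hA.det_pos.ne'.isUnit,
          Matrix.nonsing_inv_mul_cancel_right _ _ hA.det_pos.ne'.isUnit]
      have h2 : A = (Pᵀ)⁻¹ * P⁻¹ := by
        rw [← Matrix.mul_inv_rev, ← hWP, Matrix.nonsing_inv_nonsing_inv _ hA.det_pos.ne'.isUnit]
      rw [← h1, hVP, h2]
      simp only [Matrix.mul_assoc]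
      rw [Matrix.nonsing_inv_mul_cancel_left _ _ hP.isUnit,
        Matrix.mul_nonsing_inv_cancel_left _ _ hPt.isUnit]
    refine Matrix.inv_eq_left_inv ?_
    rw [hB']
    simp only [Matrix.mul_assoc]
    rw [Matrix.mul_nonsing_inv_cancel_left _ _ hPt.isUnit, ← Matrix.mul_assoc (diagonal _),
      Matrix.diagonal_mul_diagonal]
    simp [(he _).ne', Matrix.mul_nonsing_inv _ hP.isUnit]
  have hD : esymmDeriv k A⁻¹ (A⁻¹ * B * A⁻¹) =
      ∑ s ∈ (Finset.univ : Finset (Fin d)).powersetCard k, m s * ∑ i ∈ s, e i := by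
    refine (hasDerivAt_esymm_line k _ _).unique ?_
    have h1 : (fun s : ℝ => esymm k (A⁻¹ + s • (A⁻¹ * B * A⁻¹))) = fun t : ℝ =>
        ∑ s ∈ (Finset.univ : Finset (Fin d)).powersetCard k, m s * ∏ i ∈ s, (1 + t * e i) := by
      ext t
      rw [← hdiag, hVP, hWP]
      congr 1
      have : diagonal (fun i => 1 + t * e i) = 1 + t • diagonal e := by
        ext i j
        by_cases hij : i = j <;> simp [hij, diagonal]
      rw [this]
      simp [Matrix.mul_add, Matrix.add_mul]
    rw [h1]
    refine HasDerivAt.fun_sum fun s _ => HasDerivAt.const_mul _ ?_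
    have h2 := HasDerivAt.fun_finsetProd (u := s) (f := fun i t => 1 + t * e i) (f' := e) (x := 0)
      fun i _ => by simpa using ((hasDerivAt_id (0 : ℝ)).mul_const (e i)).const_add 1
    simpa using h2
  rw [hD, hW] at h
  rw [hBi, hdiag, hW]
  -- Per subset, `∏ 1/e = exp(-∑ log e) ≥ 1 - ∑ log e ≥ 1 + ∑ (1 - e)`, and `s` has `k` elements.
  have key : ∀ s ∈ (Finset.univ : Finset (Fin d)).powersetCard k,
      m s * (1 + k - ∑ i ∈ s, e i) ≤ m s * ∏ i ∈ s, (e i)⁻¹ := fun s hs => by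
    refine mul_le_mul_of_nonneg_left ?_ (hm0 s)
    have h1 : ∏ i ∈ s, (e i)⁻¹ = Real.exp (∑ i ∈ s, -Real.log (e i)) := by
      rw [Real.exp_sum]
      exact Finset.prod_congr rfl fun i _ => by rw [Real.exp_neg, Real.exp_log (he i)]
    have h2 : ∑ i ∈ s, (1 - e i) ≤ ∑ i ∈ s, -Real.log (e i) :=
      Finset.sum_le_sum fun i _ => by linarith [Real.log_le_sub_one_of_pos (he i)]
    rw [Finset.sum_sub_distrib, Finset.sum_const, (Finset.mem_powersetCard.1 hs).2, nsmul_one] at h2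
    rw [h1]
    linarith [Real.add_one_le_exp (∑ i ∈ s, -Real.log (e i))]
  have h3 := Finset.sum_le_sum key
  simp only [mul_sub, mul_add, mul_one, Finset.sum_sub_distrib, Finset.sum_add_distrib,
    ← Finset.sum_mul] at h3
  linarith

/-! ### Gradients, rank-one perturbations and duality -/

theorem _root_.Matrix.PosDef.transpose_inv_eq {M : Matrix (Fin d) (Fin d) ℝ} (hM : M.PosDef) :
    (M⁻¹)ᵀ = M⁻¹ := by
  simpa [Matrix.IsHermitian, Matrix.conjTranspose_eq_transpose_of_trivial] using
    hM.inv.isHermitian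

theorem esymmDeriv_eq_trace (k : ℕ) (V H : Matrix (Fin d) (Fin d) ℝ) :
    esymmDeriv k V H = (Hᵀ * matrixGradient (esymm k) V).trace := by
  simp only [esymmDeriv, Matrix.trace, Matrix.diag_apply, Matrix.mul_apply, Matrix.transpose_apply]
  exact Finset.sum_comm

/-- Moving `A` and `B` onto the gradient by cyclicity of the trace exhibits linearity in the entries
of `H`, as needed to integrate over designs. -/
theorem esymmDeriv_mul_mul (k : ℕ) (V A H B : Matrix (Fin d) (Fin d) ℝ) :
    esymmDeriv k V (A * H * B) =
      ∑ i, ∑ j, H i j * (Aᵀ * matrixGradient (esymm k) V * Bᵀ) i j := by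
  have h : ∀ G : Matrix (Fin d) (Fin d) ℝ, ∑ i, ∑ j, H i j * G i j = (Hᵀ * G).trace := fun G => by
    simp only [Matrix.trace, Matrix.diag_apply, Matrix.mul_apply, Matrix.transpose_apply]
    exact Finset.sum_comm
  rw [h, esymmDeriv_eq_trace, Matrix.transpose_mul, Matrix.transpose_mul, Matrix.mul_assoc,
    Matrix.trace_mul_comm, Matrix.mul_assoc, Matrix.mul_assoc, Matrix.mul_assoc]

theorem inv_Psi_smul_matrixGradient (k : ℕ) (V : Matrix (Fin d) (Fin d) ℝ) :
    (Psi k V)⁻¹ • matrixGradient (Psi k) V = (esymm k V)⁻¹ • matrixGradient (esymm k) V := by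
  have hc : ((k : ℝ) + 1) / (Nat.factorial k : ℝ) ≠ 0 := by positivity
  have h : matrixGradient (Psi k) V =
      (((k : ℝ) + 1) / (Nat.factorial k : ℝ)) • matrixGradient (esymm k) V := by
    ext i j
    simp only [matrixGradient, Psi, Matrix.of_apply, Matrix.smul_apply, smul_eq_mul]
    rw [deriv_const_mul_field]
  rw [h, smul_smul, Psi, mul_inv, mul_right_comm, inv_mul_cancel₀ hc, one_mul]

theorem det_add_smul_vecMulVec {M : Matrix (Fin d) (Fin d) ℝ} (hM : M.det ≠ 0) (x : Fin d → ℝ)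
    (s : ℝ) : (M + s • vecMulVec x x).det = M.det * (1 + s * (x ⬝ᵥ M⁻¹ *ᵥ x)) := by
  have h := Matrix.det_add_replicateCol_mul_replicateRow (ι := Unit) hM.isUnit (s • x) x
  rw [← Matrix.vecMulVec_eq Unit, Matrix.smul_vecMulVec] at h
  rw [h]
  congr 1
  rw [Matrix.det_unique, Matrix.mul_assoc, ← Matrix.replicateCol_mulVec, Matrix.mulVec_smul,
    Matrix.add_apply, Matrix.replicateRow_mul_replicateCol_apply, dotProduct_smul,
    Matrix.one_apply_eq, smul_eq_mul]

theorem inv_add_smul_vecMulVec {M : Matrix (Fin d) (Fin d) ℝ} (hM : M.det ≠ 0) (x : Fin d → ℝ)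
    {s : ℝ} (hs : 1 + s * (x ⬝ᵥ M⁻¹ *ᵥ x) ≠ 0) :
    (M + s • vecMulVec x x)⁻¹ =
      M⁻¹ - (s / (1 + s * (x ⬝ᵥ M⁻¹ *ᵥ x))) • (M⁻¹ * vecMulVec x x * M⁻¹) := by
  refine Matrix.inv_eq_right_inv ?_
  have h1 : vecMulVec x x * (M⁻¹ * vecMulVec x x * M⁻¹) =
      (x ⬝ᵥ M⁻¹ *ᵥ x) • (vecMulVec x x * M⁻¹) := by
    rw [← Matrix.mul_assoc, Matrix.mul_vecMulVec, Matrix.vecMulVec_mul_vecMulVec,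
      Matrix.vecMulVec_smul, Matrix.smul_mul]
  rw [Matrix.add_mul, Matrix.mul_sub, Matrix.mul_sub, Matrix.mul_nonsing_inv _ hM.isUnit,
    Matrix.mul_smul, Matrix.mul_assoc M⁻¹, Matrix.mul_nonsing_inv_cancel_left _ _ hM.isUnit,
    Matrix.smul_mul, Matrix.smul_mul, Matrix.mul_smul, ← Matrix.mul_assoc M⁻¹, h1]
  have h2 : ∀ Z : Matrix (Fin d) (Fin d) ℝ, ∀ q : ℝ, 1 + s * q ≠ 0 →
      1 - (s / (1 + s * q)) • Z + (s • Z - s • (s / (1 + s * q)) • q • Z) = 1 := by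
    intro Z q hq
    ext i j
    simp only [Matrix.add_apply, Matrix.sub_apply, Matrix.smul_apply, smul_eq_mul]
    field_simp
    ring
  exact h2 _ _ hs

/-- By Sherman–Morrison the inverse moves from `M⁻¹` along the fixed direction `-M⁻¹ x xᵀ M⁻¹`, with
scalar speed 1 at `s = 0`. -/
theorem hasDerivAt_esymm_inv (k : ℕ) {M : Matrix (Fin d) (Fin d) ℝ} (hM : M.det ≠ 0)
    (x : Fin d → ℝ) :
    HasDerivAt (fun s : ℝ => esymm k (M + s • vecMulVec x x)⁻¹)
      (-esymmDeriv k M⁻¹ (M⁻¹ * vecMulVec x x * M⁻¹)) 0 := by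
  set q := x ⬝ᵥ M⁻¹ *ᵥ x with hq
  set Y := M⁻¹ * vecMulVec x x * M⁻¹ with hY
  have hden : HasDerivAt (fun s : ℝ => 1 + s * q) q 0 := by
    simpa using ((hasDerivAt_id (0 : ℝ)).mul_const q).const_add 1
  have h1 : HasDerivAt (fun s : ℝ => s / (1 + s * q)) 1 0 := by
    simpa using (hasDerivAt_id (0 : ℝ)).fun_div hden (by simp)
  have h2 := hasDerivAt_esymm_comp k (γ := fun s => M⁻¹ - (s / (1 + s * q)) • Y) (H := -Y) (t := 0)
    fun i j => by simpa using (h1.mul_const (Y i j)).const_sub (M⁻¹ i j)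
  have h3 : esymmDeriv k M⁻¹ (-Y) = -esymmDeriv k M⁻¹ Y := by
    simpa using esymmDeriv_smul k (-1) M⁻¹ Y
  simp only [zero_div, zero_smul, sub_zero, h3] at h2
  refine h2.congr_of_eventuallyEq ?_
  filter_upwards [hden.continuousAt.eventually_ne (y := 0) (by simp)] with s hs
  rw [inv_add_smul_vecMulVec hM x hs]

/-- Logarithmic derivative of `E_{d-k}(M) = det M · E_k(M⁻¹)` along `M + s x xᵀ`; the determinant
contributes `xᵀ M⁻¹ x`. -/
theorem esymmDeriv_dual {k : ℕ} (hk : k ≤ d) {M : Matrix (Fin d) (Fin d) ℝ} (hM : M.PosDef)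
    (x : Fin d → ℝ) :
    esymmDeriv k M⁻¹ (M⁻¹ * vecMulVec x x * M⁻¹) / esymm k M⁻¹ =
      x ⬝ᵥ M⁻¹ *ᵥ x - esymmDeriv (d - k) M (vecMulVec x x) / esymm (d - k) M := by
  have hdet := hM.det_pos.ne'
  set q := x ⬝ᵥ M⁻¹ *ᵥ x with hq
  set Y := M⁻¹ * vecMulVec x x * M⁻¹ with hY
  have hden : HasDerivAt (fun s : ℝ => 1 + s * q) q 0 := by
    simpa using ((hasDerivAt_id (0 : ℝ)).mul_const q).const_add 1
  have h1 := (hden.const_mul M.det).mul (hasDerivAt_esymm_inv k hdet x)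
  have h2 : esymmDeriv (d - k) M (vecMulVec x x) =
      M.det * q * esymm k M⁻¹ - M.det * esymmDeriv k M⁻¹ Y := by
    refine (hasDerivAt_esymm_line (d - k) M (vecMulVec x x)).unique ?_
    have h3 : HasDerivAt (fun s : ℝ => M.det * (1 + s * q) * esymm k (M + s • vecMulVec x x)⁻¹)
        (M.det * q * esymm k M⁻¹ - M.det * esymmDeriv k M⁻¹ Y) 0 := by
      refine h1.congr_deriv ?_
      rw [zero_smul, add_zero, zero_mul, add_zero, mul_one]
      ring
    refine h3.congr_of_eventuallyEq ?_
    filter_upwards [hden.continuousAt.eventually_ne (y := 0) (by simp)] with s hs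
    have h4 := det_add_smul_vecMulVec hdet x s
    rw [esymm_sub_eq hk _ (by rw [h4]; exact mul_ne_zero hdet hs), h4]
  have hE := (esymm_pos hk hM.inv).ne'
  rw [h2, esymm_sub_eq hk M hdet]
  field_simp
  ring

/-! ### Designs and their information matrices -/

variable {T : Type*} [MeasurableSpace T]

theorem dotProduct_mulVec_matrixGradient (k : ℕ) (V : Matrix (Fin d) (Fin d) ℝ) (x : Fin d → ℝ) :
    x ⬝ᵥ matrixGradient (esymm k) V *ᵥ x = esymmDeriv k V (vecMulVec x x) := by
  simp only [dotProduct, Matrix.mulVec, esymmDeriv, Finset.mul_sum, Matrix.vecMulVec_apply]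
  exact Finset.sum_congr rfl fun i _ => Finset.sum_congr rfl fun j _ => by ring

theorem sensitivity_eq (k : ℕ) (f : T → Fin d → ℝ) {ξ : ProbabilityMeasure T}
    (hM : (infoMatrix f ξ).PosDef) (t : T) :
    sensitivity k f ξ t =
      esymmDeriv k (infoMatrix f ξ)⁻¹
        ((infoMatrix f ξ)⁻¹ * vecMulVec (f t) (f t) * (infoMatrix f ξ)⁻¹) /
          esymm k (infoMatrix f ξ)⁻¹ := by
  have hW := hM.transpose_inv_eq
  rw [sensitivity, inv_Psi_smul_matrixGradient]
  set W := (infoMatrix f ξ)⁻¹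
  have hx : f t ᵥ* W = W *ᵥ f t := by rw [← Matrix.mulVec_transpose, hW]
  rw [Matrix.mul_vecMulVec, Matrix.vecMulVec_mul, hx, ← dotProduct_mulVec_matrixGradient,
    Matrix.mul_smul, Matrix.smul_mul, Matrix.smul_mulVec, dotProduct_smul, smul_eq_mul,
    ← Matrix.mulVec_mulVec, ← Matrix.mulVec_mulVec, Matrix.dotProduct_mulVec (f t) W, hx,
    div_eq_inv_mul]

theorem dualSensitivity_eq {k : ℕ} (hk : k ≤ d) (f : T → Fin d → ℝ) {ξ : ProbabilityMeasure T}
    (hM : (infoMatrix f ξ).PosDef) : dualSensitivity k f ξ = sensitivity k f ξ := by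
  ext t
  rw [sensitivity_eq k f hM, esymmDeriv_dual hk hM, dualSensitivity, inv_Psi_smul_matrixGradient,
    Matrix.smul_mulVec, dotProduct_smul, dotProduct_mulVec_matrixGradient, smul_eq_mul,
    div_eq_inv_mul]

theorem integrable_mul_coord {f : T → Fin d → ℝ} (hf : Measurable f)
    (hcpt : IsCompact (Set.range f)) (μ : Measure T) [IsFiniteMeasure μ] (i j : Fin d) :
    Integrable (fun t => f t i * f t j) μ := by
  obtain ⟨C, hC⟩ := hcpt.isBounded.exists_norm_le
  have hm : ∀ i, Measurable fun t => f t i := fun i => (measurable_pi_apply i).comp hf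
  refine Integrable.of_bound ((hm i).mul (hm j)).aestronglyMeasurable (C * C) (ae_of_all _ fun t => ?_)
  have hb : ∀ i, ‖f t i‖ ≤ C := fun i => (norm_le_pi_norm (f t) i).trans (hC _ ⟨t, rfl⟩)
  rw [norm_mul]
  exact mul_le_mul (hb i) (hb j) (norm_nonneg _) ((norm_nonneg _).trans (hb i))

theorem integral_esymmDeriv {f : T → Fin d → ℝ} (hf : Measurable f)
    (hcpt : IsCompact (Set.range f)) (k : ℕ) (V W : Matrix (Fin d) (Fin d) ℝ)
    (ν : ProbabilityMeasure T) :
    Integrable (fun t => esymmDeriv k V (W * vecMulVec (f t) (f t) * W)) (ν : Measure T) ∧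
    ∫ t, esymmDeriv k V (W * vecMulVec (f t) (f t) * W) ∂(ν : Measure T) =
      esymmDeriv k V (W * infoMatrix f ν * W) := by
  simp only [esymmDeriv_mul_mul, Matrix.vecMulVec_apply]
  have h := fun i j => (integrable_mul_coord hf hcpt (ν : Measure T) i j).mul_const
    ((Wᵀ * matrixGradient (esymm k) V * Wᵀ) i j)
  refine ⟨integrable_finsetSum _ fun i _ => integrable_finsetSum _ fun j _ => h i j, ?_⟩
  rw [integral_finsetSum _ fun i _ => integrable_finsetSum _ fun j _ => h i j]
  refine Finset.sum_congr rfl fun i _ => ?_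
  rw [integral_finsetSum _ fun j _ => h i j]
  refine Finset.sum_congr rfl fun j _ => ?_
  rw [integral_mul_const, infoMatrix, Matrix.of_apply]

theorem continuous_esymmDeriv (k : ℕ) (V W : Matrix (Fin d) (Fin d) ℝ) :
    Continuous fun x : Fin d → ℝ => esymmDeriv k V (W * vecMulVec x x * W) := by
  simp only [esymmDeriv_mul_mul, Matrix.vecMulVec_apply]
  fun_prop

theorem posSemidef_infoMatrix {f : T → Fin d → ℝ} (hf : Measurable f)
    (hcpt : IsCompact (Set.range f)) (ν : ProbabilityMeasure T) :
    (infoMatrix f ν).PosSemidef := by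
  refine Matrix.PosSemidef.of_dotProduct_mulVec_nonneg ?_ fun x => ?_
  · ext i j
    simp [infoMatrix, mul_comm]
  · have h : star x ⬝ᵥ infoMatrix f ν *ᵥ x = ∫ t, (x ⬝ᵥ f t) ^ 2 ∂(ν : Measure T) := by
      have h1 := fun i j =>
        ((integrable_mul_coord hf hcpt (ν : Measure T) i j).const_mul (x i * x j))
      have h2 : (fun t => (x ⬝ᵥ f t) ^ 2) = fun t =>
          ∑ i, ∑ j, x i * x j * (f t i * f t j) := by
        ext t
        rw [sq, dotProduct, Finset.sum_mul_sum]
        exact Finset.sum_congr rfl fun i _ => Finset.sum_congr rfl fun j _ => by ring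
      rw [h2, integral_finsetSum _ fun i _ => integrable_finsetSum _ fun j _ => h1 i j]
      simp only [dotProduct, Matrix.mulVec, Finset.mul_sum, star_trivial]
      refine Finset.sum_congr rfl fun i _ => ?_
      rw [integral_finsetSum _ fun j _ => h1 i j]
      refine Finset.sum_congr rfl fun j _ => ?_
      rw [integral_const_mul, infoMatrix, Matrix.of_apply]
      ring
    rw [h]
    exact integral_nonneg fun t => sq_nonneg _

/-- Weights `1/(1+s)` on `ξ` and `s/(1+s)` on the point mass at `t`. The common factor leaves a pure
rank-one perturbation, and homogeneity absorbs it later. -/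
theorem exists_mixture {f : T → Fin d → ℝ} (hf : Measurable f)
    (hcpt : IsCompact (Set.range f)) (ξ : ProbabilityMeasure T) (t : T) {s : ℝ} (hs : 0 ≤ s) :
    ∃ ν : ProbabilityMeasure T,
      infoMatrix f ν = (1 + s)⁻¹ • (infoMatrix f ξ + s • vecMulVec (f t) (f t)) := by
  have h0 : 0 ≤ (1 + s)⁻¹ := by positivity
  have h1 : 0 ≤ s * (1 + s)⁻¹ := by positivity
  refine ⟨⟨ENNReal.ofReal (1 + s)⁻¹ • (ξ : Measure T) +
    ENNReal.ofReal (s * (1 + s)⁻¹) • Measure.dirac t, ⟨?_⟩⟩, ?_⟩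
  · simp only [Measure.add_apply, Measure.smul_apply, measure_univ, smul_eq_mul, mul_one]
    rw [← ENNReal.ofReal_add h0 h1, ← ENNReal.ofReal_one]
    congr 1
    field_simp
  · ext i j
    have hm : ∀ i, Measurable fun t => f t i := fun i => (measurable_pi_apply i).comp hf
    have hint := fun μ : Measure T => fun _ : IsFiniteMeasure μ =>
      integrable_mul_coord hf hcpt μ i j
    simp only [infoMatrix, Matrix.of_apply, Matrix.smul_apply, Matrix.add_apply,
      Matrix.vecMulVec_apply, smul_eq_mul, ProbabilityMeasure.coe_mk]
    rw [integral_add_measure ((hint _ inferInstance).smul_measure ENNReal.ofReal_ne_top)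
        ((hint _ inferInstance).smul_measure ENNReal.ofReal_ne_top),
      integral_smul_measure, integral_smul_measure,
      integral_dirac' (fun t => f t i * f t j) t ((hm i).mul (hm j)).stronglyMeasurable,
      ENNReal.toReal_ofReal h0, ENNReal.toReal_ofReal h1]
    simp only [smul_eq_mul]
    ring

/-! ### Optimality and the equivalence theorem -/

theorem isOptimal_iff {k : ℕ} (hk : 1 ≤ k) (hkd : k ≤ d) (f : T → Fin d → ℝ)
    {ξ : ProbabilityMeasure T} (hξ : (infoMatrix f ξ).PosDef) :
    IsOptimal k f ξ ↔ ∀ ν : ProbabilityMeasure T, (infoMatrix f ν).PosDef →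
      esymm k (infoMatrix f ξ)⁻¹ ≤ esymm k (infoMatrix f ν)⁻¹ := by
  have hc : 0 < ((k : ℝ) + 1) / (Nat.factorial k : ℝ) := by positivity
  have hP : ∀ V : Matrix (Fin d) (Fin d) ℝ, V.PosDef → 0 < Psi k V := fun V hV =>
    mul_pos hc (esymm_pos hkd hV)
  have hk0 : -(1 / (k : ℝ)) < 0 := by
    exact neg_neg_of_pos (by positivity)
  refine forall_congr' fun ν => ?_
  rw [criterion, criterion, if_pos hξ]
  by_cases hν : (infoMatrix f ν).PosDef
  · rw [if_pos hν, Real.rpow_le_rpow_iff_of_neg (hP _ hν.inv) (hP _ hξ.inv) hk0, Psi, Psi,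
      mul_le_mul_iff_right₀ hc]
    simp [hν]
  · rw [if_neg hν]
    simp [hν, Real.rpow_nonneg (hP _ hξ.inv).le]

theorem isOptimal_iff_sensitivity_le {k : ℕ} (hk : 1 ≤ k) (hkd : k ≤ d) {f : T → Fin d → ℝ}
    (hf : Measurable f) (hcpt : IsCompact (Set.range f)) {ξ : ProbabilityMeasure T}
    (hξ : (infoMatrix f ξ).PosDef) :
    IsOptimal k f ξ ↔ ∀ t, sensitivity k f ξ t ≤ k := by
  rw [isOptimal_iff hk hkd f hξ]
  have hE := esymm_pos hkd hξ.inv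
  refine ⟨fun h t => ?_, fun h ν hν => ?_⟩
  · rw [sensitivity_eq k f hξ, div_le_iff₀ hE]
    -- For `s ≥ 0`, `(1+s)^k E_k((M + s f fᵀ)⁻¹)` is `E_k` of the inverse information matrix of a
    -- mixture, so optimality makes `s = 0` its minimum there.
    have hd := (((hasDerivAt_id (0 : ℝ)).const_add 1).pow k).mul
      (hasDerivAt_esymm_inv k hξ.det_pos.ne' (f t))
    simp only [id, zero_smul, add_zero, Pi.pow_apply, one_pow, mul_one, one_mul] at hd
    have hmin : ∀ s : ℝ, 0 ≤ s → esymm k (infoMatrix f ξ)⁻¹ ≤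
        (1 + s) ^ k * esymm k (infoMatrix f ξ + s • vecMulVec (f t) (f t))⁻¹ := fun s hs => by
      obtain ⟨ν, hν⟩ := exists_mixture hf hcpt ξ t hs
      have hp : (infoMatrix f ξ + s • vecMulVec (f t) (f t)).PosDef :=
        hξ.add_posSemidef ((by simpa using Matrix.posSemidef_vecMulVec_self_star (f t) :
          (vecMulVec (f t) (f t)).PosSemidef).smul hs)
      have hs1 : 0 < (1 + s)⁻¹ := by positivity
      have h1 := h ν (by rw [hν]; exact hp.smul hs1)
      have h2 : ((1 + s)⁻¹ • (infoMatrix f ξ + s • vecMulVec (f t) (f t)))⁻¹ =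
          (1 + s) • (infoMatrix f ξ + s • vecMulVec (f t) (f t))⁻¹ := by
        refine Matrix.inv_eq_right_inv ?_
        rw [Matrix.smul_mul, Matrix.mul_smul, smul_smul, Matrix.mul_nonsing_inv _ hp.det_pos.ne'.isUnit,
          inv_mul_cancel₀ (by positivity), one_smul]
      rwa [hν, h2, esymm_smul] at h1
    have hlim := hd.tendsto_slope_zero_right
    have hnn := ge_of_tendsto hlim (b := 0) (by
      filter_upwards [self_mem_nhdsWithin] with s hs
      have hs' : (0 : ℝ) < s := hs
      have := hmin s hs'.le
      simp only [Pi.mul_apply, Pi.pow_apply, zero_add, add_zero, one_pow, zero_smul, one_mul,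
        smul_eq_mul]
      exact mul_nonneg (inv_nonneg.2 hs'.le) (sub_nonneg.2 this))
    linarith
  · refine esymm_inv_le_of_esymmDeriv_le hkd hξ hν ?_
    obtain ⟨hi, he⟩ := integral_esymmDeriv hf hcpt k (infoMatrix f ξ)⁻¹ (infoMatrix f ξ)⁻¹ ν
    rw [← he]
    have h1 : ∀ t, esymmDeriv k (infoMatrix f ξ)⁻¹
        ((infoMatrix f ξ)⁻¹ * vecMulVec (f t) (f t) * (infoMatrix f ξ)⁻¹) ≤
          k * esymm k (infoMatrix f ξ)⁻¹ := fun t => by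
      have := h t
      rwa [sensitivity_eq k f hξ, div_le_iff₀ hE] at this
    simpa using integral_mono hi (integrable_const _) h1

theorem sensitivity_eq_of_isOptimal {k : ℕ} (hk : 1 ≤ k) (hkd : k ≤ d) {f : T → Fin d → ℝ}
    (hf : Measurable f) (hcpt : IsCompact (Set.range f)) {ξ : ProbabilityMeasure T}
    (hξ : (infoMatrix f ξ).PosDef) (hopt : IsOptimal k f ξ) {t : T}
    (ht : f t ∈ ((ξ : Measure T).map f).support) : sensitivity k f ξ t = k := by
  have hle := (isOptimal_iff_sensitivity_le hk hkd hf hcpt hξ).1 hopt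
  have hE := esymm_pos hkd hξ.inv
  by_contra hne
  have hlt := lt_of_le_of_ne (hle t) hne
  set W := (infoMatrix f ξ)⁻¹ with hW
  set g : (Fin d → ℝ) → ℝ := fun x => esymmDeriv k W (W * vecMulVec x x * W) / esymm k W with hg
  have hgc : Continuous g := (continuous_esymmDeriv k W W).div_const _
  have hs : ∀ t, sensitivity k f ξ t = g (f t) := sensitivity_eq k f hξ
  obtain ⟨hi, he⟩ := integral_esymmDeriv hf hcpt k W W ξ
  have hgi : Integrable (fun t => g (f t)) (ξ : Measure T) := hi.div_const _
  -- Integration replaces `f fᵀ` by `M`; since `W M W = W`, Euler's identity gives `g ∘ f` mean `k`.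
  have hint : ∫ t, ((k : ℝ) - g (f t)) ∂(ξ : Measure T) = 0 := by
    rw [integral_sub (integrable_const _) hgi, hg, integral_div, he, hW,
      Matrix.nonsing_inv_mul _ hξ.det_pos.ne'.isUnit, Matrix.one_mul, esymmDeriv_self,
      mul_div_cancel_right₀ _ hE.ne']
    simp
  have hae := (integral_eq_zero_iff_of_nonneg (fun t => sub_nonneg.2 (hs t ▸ hle t))
    ((integrable_const _).sub hgi)).1 hint
  have hU : IsOpen {x | g x < k} := isOpen_lt hgc continuous_const
  have hpos := (Measure.mem_support_iff_forall _).1 ht _ (hU.mem_nhds (by rw [hs] at hlt; exact hlt))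
  rw [Measure.map_apply hf hU.measurableSet] at hpos
  -- The open set `g < k` would have positive image measure, although `g ∘ f = k` almost everywhere.
  refine hpos.ne' (measure_mono_null (fun u hu => ?_) hae)
  exact fun h => (sub_pos.2 hu).ne' h

theorem map_mem_support [TopologicalSpace T] {f : T → Fin d → ℝ} (hf : Measurable f)
    {μ : Measure T} {t : T} (ht : t ∈ μ.support) (hc : ContinuousAt f t) :
    f t ∈ (μ.map f).support := by
  refine (Measure.mem_support_iff_forall _).2 fun U hU => ?_
  obtain ⟨V, hVU, hV, htV⟩ := mem_nhds_iff.1 hU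
  refine lt_of_lt_of_le ?_ (measure_mono hVU)
  rw [Measure.map_apply hf hV.measurableSet]
  exact (Measure.mem_support_iff_forall _).1 ht _ (hc (hV.mem_nhds htV))

/-- The maximum is attained because the expression is a continuous function of `f t`, which ranges
over a compact set; no continuity of `f` is involved. -/
theorem forall_sensitivity_le_iff {k : ℕ} {f : T → Fin d → ℝ} (hcpt : IsCompact (Set.range f))
    {ξ : ProbabilityMeasure T} (hξ : (infoMatrix f ξ).PosDef) (c : ℝ) :
    (∀ t, sensitivity k f ξ t ≤ c) ↔
      ∃ m, IsGreatest (Set.range (sensitivity k f ξ)) m ∧ m ≤ c := by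
  have : Nonempty T := (ξ : Measure T).nonempty_of_neZero
  constructor
  · intro h
    have hr : Set.range (sensitivity k f ξ) = (fun x => esymmDeriv k (infoMatrix f ξ)⁻¹
        ((infoMatrix f ξ)⁻¹ * vecMulVec x x * (infoMatrix f ξ)⁻¹) /
          esymm k (infoMatrix f ξ)⁻¹) '' Set.range f := by
      rw [← Set.range_comp]
      exact congrArg Set.range (funext (sensitivity_eq k f hξ))
    have hc : IsCompact (Set.range (sensitivity k f ξ)) := by
      rw [hr]
      exact hcpt.image ((continuous_esymmDeriv k _ _).div_const _)
    obtain ⟨m, hm⟩ := hc.exists_isGreatest (Set.range_nonempty _)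
    obtain ⟨t, rfl⟩ := hm.1
    exact ⟨_, hm, h t⟩
  · rintro ⟨m, hm, hmc⟩ t
    exact (hm.2 ⟨t, rfl⟩).trans hmc

end OptDesign

end

theorem theorem6 {d : ℕ} (k : ℕ) (hk : 1 ≤ k) (hkd : k ≤ d)
    {T : Type*} [MeasurableSpace T] [TopologicalSpace T]
    (f : T → Fin d → ℝ) (hf : Measurable f) (hcpt : IsCompact (Set.range f))
    (ξ : ProbabilityMeasure T) (hξ : (OptDesign.infoMatrix f ξ).PosDef) :
    -- first characterisation: the maximum exists and is at most `k`
    (OptDesign.IsOptimal k f ξ ↔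
      ∃ m, IsGreatest (Set.range (OptDesign.sensitivity k f ξ)) m ∧ m ≤ (k : ℝ)) ∧
    -- second characterisation: the maximum exists and is also at most `k`
    (OptDesign.IsOptimal k f ξ ↔
      ∃ m, IsGreatest (Set.range (OptDesign.dualSensitivity k f ξ)) m ∧ m ≤ (k : ℝ)) ∧
    -- equality on the support of an optimal design
    (OptDesign.IsOptimal k f ξ → ∀ t : T,
      (t ∈ (ξ : Measure T).support ∧ ContinuousAt f t) ∨
        f t ∈ ((ξ : Measure T).map f).support →
      OptDesign.sensitivity k f ξ t = (k : ℝ) ∧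
        OptDesign.dualSensitivity k f ξ t = (k : ℝ)) ∧
    -- `k = 1` is A-optimality
    (k = 1 → (OptDesign.IsOptimal k f ξ ↔
      ∀ ν : ProbabilityMeasure T, (OptDesign.infoMatrix f ν).PosDef →
        (OptDesign.infoMatrix f ξ)⁻¹.trace ≤ (OptDesign.infoMatrix f ν)⁻¹.trace)) ∧
    -- `k = d` is D-optimality
    (k = d → (OptDesign.IsOptimal k f ξ ↔
      ∀ ν : ProbabilityMeasure T,
        (OptDesign.infoMatrix f ν).det ≤ (OptDesign.infoMatrix f ξ).det)) := by
  rw [OptDesign.dualSensitivity_eq hkd f hξ, ← OptDesign.forall_sensitivity_le_iff hcpt hξ]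
  have h := OptDesign.isOptimal_iff_sensitivity_le hk hkd hf hcpt hξ
  refine ⟨h, h, fun hopt t ht => ?_, ?_, ?_⟩
  · rw [and_self]
    refine OptDesign.sensitivity_eq_of_isOptimal hk hkd hf hcpt hξ hopt ?_
    exact ht.elim (fun ht => OptDesign.map_mem_support hf ht.1 ht.2) id
  · rintro rfl
    simp only [OptDesign.isOptimal_iff hk hkd f hξ, OptDesign.esymm_one]
  · rintro rfl
    simp only [OptDesign.isOptimal_iff hk hkd f hξ, OptDesign.esymm_self]
    refine forall_congr' fun ν => ?_
    by_cases hν : (OptDesign.infoMatrix f ν).PosDef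
    · simp only [hν, forall_const, Matrix.det_nonsing_inv, Ring.inverse_eq_inv']
      exact inv_le_inv₀ hξ.det_pos hν.det_pos
    -- D-optimality also ranges over singular designs; being positive semidefinite, these have
    -- determinant 0 and impose no constraint.
    · have h0 : (OptDesign.infoMatrix f ν).det = 0 := by
        by_contra h0
        exact hν ((OptDesign.posSemidef_infoMatrix hf hcpt ν).posDef_iff_det_ne_zero.2 h0)
      simp [hν, h0, hξ.det_pos.le]
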